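/- Let $P_{10}$ be the Petersen graph and let $P:=P_{10}-z$ for a vertex $z$ of $P_{10}$; $P$ has exactly three $2$-valent vertices. For a cubic graph $G$, the $P$-inflation of $G$ at every vertex replaces each vertex $v$ of $G$ by a copy $P_v$ of $P$ and each edge $uv$ of $G$ by an edge joining a $2$-valent vertex of $P_u$ to a $2$-valent vertex of $P_v$, such that for every $v$ the edges of $G$ at $v$ are attached to distinct $2$-valent vertices of $P_v$. Put $P_{10}^0:=P_{10}$ and let $P_{10}^{k}$ arise from $P_{10}^{k-1}$ by $P$-inflation at every vertex. A Kotzig graph is a cubic graph (parallel edges allowed) that has a $3$-edge-coloring such that each pair of color classes forms a hamiltonian circuit. Then for every $k\ge 1$ the iterated Petersen graph $P_{10}^k$ exists, and (for every choice of the attachments made in its construction) it is a $3$-connected cubic graph which has no spanning subgraph that is a subdivision of a Kotzig graph. In particular, the conjecture of Häggkvist and Markström that every $3$-connected cubic graph has a spanning subgraph which is a subdivision of a Kotzig graph is false. -/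

import Mathlib

open scoped Graph

namespace KotzigFrame

/-! ### The Petersen graph and the graph `P` -/

/-- The Petersen graph on `Fin 10`: the outer 5-cycle `0 1 2 3 4`, the inner pentagram on
`5, …, 9` (with `5 + i` joined to `5 + (i + 2 mod 5)`), and the spokes joining `i` to `5 + i`. -/
def petersen : SimpleGraph (Fin 10) :=
  SimpleGraph.fromRel fun i j =>
    (i.val < 5 ∧ j.val = (i.val + 1) % 5) ∨
    (i.val < 5 ∧ j.val = i.val + 5) ∨
    (5 ≤ i.val ∧ j.val = (i.val - 5 + 2) % 5 + 5)

instance : DecidableRel petersen.Adj := by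
  unfold petersen
  infer_instance

/-- The vertices of `P`: all vertices of the Petersen graph but the vertex `z = 0`
(the Petersen graph is vertex-transitive, so the choice of `z` does not matter). -/
abbrev PVert : Type := {v : Fin 10 // v ≠ 0}

/-- The graph `P`: the Petersen graph minus one vertex. -/
def pGraph : SimpleGraph PVert := petersen.comap Subtype.val

instance : DecidableRel pGraph.Adj := by
  unfold pGraph
  infer_instance

/-! ### `P`-inflations -/

/-- The choices made when `P`-inflating `G` at every vertex: in the copy of `P` that replaces `v`,
the edge from `v` to its neighbor `u` is attached at `port v u`, a 2-valent vertex of `P`,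
and distinct neighbors of `v` get distinct 2-valent vertices.
(The values of `port` at non-adjacent pairs play no role.) -/
structure Attachment {V : Type*} (G : SimpleGraph V) where
  port : V → V → PVert
  degree_port : ∀ v u, G.Adj v u → pGraph.degree (port v u) = 2
  injOn_port : ∀ v, Set.InjOn (port v) (G.neighborSet v)

/-- The `P`-inflation of `G` at every vertex, with attachment `a`: every vertex `v` is replaced by
the copy `{v} × P` of `P`, and every edge `vu` of `G` becomes an edge between the chosen 2-valent
vertices of the copies at `v` and at `u`. -/
def inflate {V : Type*} (G : SimpleGraph V) (a : Attachment G) : SimpleGraph (V × PVert) where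
  Adj x y := (x.1 = y.1 ∧ pGraph.Adj x.2 y.2) ∨
    (G.Adj x.1 y.1 ∧ x.2 = a.port x.1 y.1 ∧ y.2 = a.port y.1 x.1)
  symm := ⟨by
    rintro x y (⟨h, h'⟩ | ⟨h, h₁, h₂⟩)
    · exact Or.inl ⟨h.symm, h'.symm⟩
    · exact Or.inr ⟨h.symm, h₂, h₁⟩⟩
  loopless := ⟨by
    rintro x (⟨-, h⟩ | ⟨h, -⟩)
    · exact pGraph.irrefl h
    · exact G.irrefl h⟩

/-- The vertex type of the `k`-th iterated inflation of a graph on `V`. -/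
def IterVert (V : Type) : ℕ → Type
  | 0 => V
  | k + 1 => IterVert V k × PVert

/-- `IsIterate G k G'` says that `G'` is (one choice of attachments for) `G ^ k`: it arises from `G`
by `k` times applying the `P`-inflation at every vertex. -/
def IsIterate {V : Type} (G : SimpleGraph V) : (k : ℕ) → SimpleGraph (IterVert V k) → Prop
  | 0, G' => G' = G
  | k + 1, G' => ∃ (F : SimpleGraph (IterVert V k)) (a : Attachment F),
      IsIterate G k F ∧ G' = inflate F a

/-! ### Cubic graphs and connectivity -/

/-- Every vertex has exactly three neighbors. -/
def IsCubic {V : Type*} (G : SimpleGraph V) : Prop :=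
  ∀ v, (G.neighborSet v).encard = 3

/-- `k`-connectedness (vertex connectivity): there are more than `k` vertices, and deleting fewer
than `k` vertices leaves a connected graph. -/
def IsVertexConnected {V : Type*} (k : ℕ) (G : SimpleGraph V) : Prop :=
  (k : ℕ∞) < ENat.card V ∧
    ∀ S : Finset V, S.card < k → (G.induce {v | v ∉ S}).Connected

/-! ### Kotzig graphs (parallel edges allowed) -/

/-- Every vertex of the multigraph has degree three; loops count twice. -/
def IsCubicMulti {α β : Type*} (K : Graph α β) : Prop :=
  ∀ v ∈ V(K), {e | K.IsNonloopAt e v}.encard + 2 * {e | K.IsLoopAt e v}.encard = 3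

/-- The edge set `F` forms a hamiltonian circuit of `K`: the vertices of `K` and the edges of `F`
can be arranged cyclically, each exactly once, as `v 0, e 0, v 1, e 1, …, v (n-1), e (n-1), v 0`.
A circuit of length 2 consists of two parallel edges. -/
def IsHamiltonianCircuit {α β : Type*} (K : Graph α β) (F : Set β) : Prop :=
  ∃ (n : ℕ) (v : ZMod n → α) (e : ZMod n → β), n ≠ 0 ∧
    Set.BijOn v Set.univ V(K) ∧ Set.BijOn e Set.univ F ∧
    ∀ i, K.IsLink (e i) (v i) (v (i + 1))

/-- `c` is a (proper) edge coloring of `K`: there are no loops, and distinct edges with a common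
end get distinct colors. -/
def IsEdgeColoring {α β γ : Type*} (K : Graph α β) (c : β → γ) : Prop :=
  (∀ e v, ¬ K.IsLoopAt e v) ∧
    ∀ e f v, K.Inc e v → K.Inc f v → e ≠ f → c e ≠ c f

/-- A Kotzig graph: a cubic graph with a 3-edge coloring such that each pair of color classes
forms a hamiltonian circuit. -/
def IsKotzig {α β : Type*} (K : Graph α β) : Prop :=
  IsCubicMulti K ∧ ∃ c : β → Fin 3, IsEdgeColoring K c ∧
    ∀ i j, i ≠ j → IsHamiltonianCircuit K {e | e ∈ E(K) ∧ (c e = i ∨ c e = j)}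

/-! ### Subdivisions -/

/-- A representation of the simple graph `H` as a subdivision of the multigraph `K`: vertices of `K`
correspond to distinct branch vertices of `H`, every edge `e` of `K` is replaced by a path of `H`
between the branch vertices of its ends (a cycle if `e` is a loop), these paths meet each other and
the branch vertices only in their ends, and together they make up all of `H`. -/
structure Subdivision {V α β : Type*} (H : SimpleGraph V) (K : Graph α β) where
  branch : α → V
  injOn_branch : Set.InjOn branch V(K)
  src : E(K) → α
  tgt : E(K) → α
  isLink : ∀ e : E(K), K.IsLink e (src e) (tgt e)
  path : ∀ e : E(K), H.Walk (branch (src e)) (branch (tgt e))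
  isPath : ∀ e, src e ≠ tgt e → (path e).IsPath
  isCycle : ∀ e, ∀ h : src e = tgt e, ((path e).copy rfl (congrArg branch h.symm)).IsCycle
  branch_mem : ∀ e, ∀ x ∈ V(K), branch x ∈ (path e).support → x = src e ∨ x = tgt e
  support_inter : ∀ e f, e ≠ f → ∀ v, v ∈ (path e).support → v ∈ (path f).support →
    ∃ x ∈ V(K), branch x = v
  edges_disjoint : ∀ e f, e ≠ f → ∀ d, d ∈ (path e).edges → d ∉ (path f).edges
  cover_vertex : ∀ v, (∃ x ∈ V(K), branch x = v) ∨ ∃ e, v ∈ (path e).support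
  cover_edge : ∀ d ∈ H.edgeSet, ∃ e, d ∈ (path e).edges

/-- `G` has a spanning subgraph which is a subdivision of a Kotzig graph. -/
def HasSpanningKotzigSubdivision {V : Type*} (G : SimpleGraph V) : Prop :=
  ∃ H : SimpleGraph V, H ≤ G ∧
    ∃ (α β : Type) (K : Graph α β), IsKotzig K ∧ Nonempty (Subdivision H K)

/-- The conjecture of Häggkvist and Markström: every (finite) 3-connected cubic graph has a spanning
subgraph which is a subdivision of a Kotzig graph. -/
def HaggkvistMarkstromConjecture : Prop :=
  ∀ (V : Type) [Finite V] (G : SimpleGraph V), IsVertexConnected 3 G → IsCubic G →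
    HasSpanningKotzigSubdivision G

end KotzigFrame

/-! Only part of a spanning Kotzig subdivision matters, recorded in `Frame`: three edge-disjoint
colour graphs `M i` and the set `B` of branch vertices. The claim is that a frame in a `P`-inflation
of a cubic `F` makes `F` 3-edge-colorable (`Frame.isTait`).

Every copy of `P` contains a branch vertex (`Frame.exists_mem_copy`). Otherwise, contracting the
rest of the graph to the removed vertex would give a subgraph of the Petersen graph that is
2-regular off that vertex. Such a subgraph has a union of components avoiding the vertex
(`petersen_exists_odd_closed`), hence a piece of the subdivision without branch vertices.

By degree sums, the number of edges of each colour leaving a copy has the parity of the number of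
branch vertices in it (`Frame.even_cut_iff`). Were this even, two of the colours would not leave the
copy at all, as only three edges do. Their hamiltonian circuit would then be confined to one copy,
although other copies contain branch vertices too. So every colour leaves every copy an odd number
of times, hence exactly once, and this colours `F`.

No iterate is 3-edge-colorable: the Petersen graph is not, and since `P` has nine vertices a
colouring of an inflation descends to the base graph by the same parity count (`isTait_of_inflate`).
-/

namespace KotzigFrame

/-! ### The Petersen graph -/

-- Internally disjoint paths of lengths 2, 3 and 3; at least one survives the deletion of two inner
-- vertices.
set_option synthInstance.maxHeartbeats 400000 in
set_option synthInstance.maxSize 1000 in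
set_option maxSynthPendingDepth 10 in
theorem petersen_three_paths : ∀ p q : Fin 10, p ≠ q → ¬ petersen.Adj p q →
    ∃ c, petersen.Adj p c ∧ petersen.Adj c q ∧
      ∃ a, petersen.Adj p a ∧ a ≠ c ∧ ∃ b, petersen.Adj a b ∧ petersen.Adj b q ∧ b ≠ c ∧
        ∃ a', petersen.Adj p a' ∧ a' ≠ c ∧ a' ≠ a ∧ a' ≠ b ∧
          ∃ b', petersen.Adj a' b' ∧ petersen.Adj b' q ∧ b' ≠ c ∧ b' ≠ a ∧ b' ≠ b := by
  decide +kernel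

/-- Deleting two vertices `s`, `t` of the Petersen graph leaves any two other vertices at distance at
most three. -/
theorem petersen_short_path {p q : Fin 10} (s t : Fin 10) (hpq : p ≠ q) :
    petersen.Adj p q ∨ (∃ a, (a ≠ s ∧ a ≠ t) ∧ petersen.Adj p a ∧ petersen.Adj a q) ∨
      ∃ a b, (a ≠ s ∧ a ≠ t) ∧ (b ≠ s ∧ b ≠ t) ∧
        petersen.Adj p a ∧ petersen.Adj a b ∧ petersen.Adj b q := by
  by_cases h : petersen.Adj p q
  · exact Or.inl h
  obtain ⟨c, pc, cq, a, pa, ac, b, ab, bq, bc, a', pa', ac', aa, ab', b', hab', bq', bc', ba, bb⟩ :=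
    petersen_three_paths p q hpq h
  by_cases hc : c ≠ s ∧ c ≠ t
  · exact Or.inr (Or.inl ⟨c, hc, pc, cq⟩)
  -- One of `s`, `t` is `c`, so the other one meets at most one of the two remaining paths.
  by_cases h1 : (a ≠ s ∧ a ≠ t) ∧ (b ≠ s ∧ b ≠ t)
  · exact Or.inr (Or.inr ⟨a, b, h1.1, h1.2, pa, ab, bq⟩)
  · refine Or.inr (Or.inr ⟨a', b', ?_, ?_, pa', hab', bq'⟩) <;> grind

/-! ### Two-factors of the Petersen graph -/

/-- Exactly two of three Booleans are true. -/
def twoOfThree (a b c : Bool) : Bool := (a && b && !c) || (a && !b && c) || (!a && b && c)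

-- The fifteen Booleans are the edges of the Petersen graph, each hypothesis the degree condition at
-- one of the vertices 1 to 9. By the handshake lemma the degree at 0 is 0 or 2. The first
-- alternative is degree 0; in the others the missing edges contain one of the six perfect
-- matchings.
set_option synthInstance.maxHeartbeats 400000 in
set_option synthInstance.maxSize 1000 in
set_option maxSynthPendingDepth 10 in
theorem petersen_two_factor_bool : ∀ a b c : Bool, twoOfThree a b c = true →
    ∀ d e : Bool, twoOfThree b d e = true → ∀ f g : Bool, twoOfThree d f g = true →
    ∀ h i : Bool, twoOfThree f h i = true →
    ∀ j k l : Bool, twoOfThree j k l = true → ∀ m n : Bool, twoOfThree c m n = true →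
    ∀ o : Bool, twoOfThree e k o = true → twoOfThree g m l = true → twoOfThree i o n = true →
    (a || h || j) = false ∨
    (a || d || i || k || m) = false ∨ (a || f || e || l || n) = false ∨
    (b || f || j || m || o) = false ∨ (b || h || g || k || n) = false ∨
    (d || h || c || o || l) = false ∨ (j || c || e || g || i) = false := by
  decide +kernel

theorem twoOfThree_of_ncard {V : Type*} {Q : SimpleGraph V} {x a b c : V} [DecidableRel Q.Adj]
    (hab : a ≠ b) (hac : a ≠ c) (hbc : b ≠ c) (h : Q.neighborSet x ⊆ {a, b, c})
    (h2 : (Q.neighborSet x).ncard = 2) :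
    twoOfThree (decide (Q.Adj x a)) (decide (Q.Adj x b)) (decide (Q.Adj x c)) = true := by
  classical
  have key : Q.neighborSet x = (({a, b, c} : Finset V).filter (Q.Adj x) : Finset V) := by
    ext y
    simp only [SimpleGraph.mem_neighborSet, Finset.coe_filter, Finset.mem_insert,
      Finset.mem_singleton, Set.mem_ofPred_eq]
    exact ⟨fun hy => ⟨by simpa using h hy, hy⟩, fun hy => hy.2⟩
  rw [key, Set.ncard_coe_finset] at h2
  by_cases ha : Q.Adj x a <;> by_cases hb : Q.Adj x b <;> by_cases hc : Q.Adj x c <;>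
    simp_all [Finset.filter_insert, Finset.filter_singleton, twoOfThree]

/-- The edges of `Q` leave no vertex of `C`, if the edges of the Petersen graph leaving `C` are
among a list of pairs not adjacent in `Q`. -/
theorem closed_of_list {Q : SimpleGraph (Fin 10)} (hQ : Q ≤ petersen) (C : Finset (Fin 10))
    (L : List (Fin 10 × Fin 10)) (hL : ∀ e ∈ L, ¬ Q.Adj e.1 e.2)
    (h : ∀ x ∈ C, ∀ y, petersen.Adj x y → y ∈ C ∨ (x, y) ∈ L) :
    ∀ x ∈ C, ∀ y, Q.Adj x y → y ∈ C :=
  fun x hx y hxy => (h x hx y (hQ hxy)).resolve_right fun hm => hL _ hm hxy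

/-- A spanning subgraph of the Petersen graph that is 2-regular away from the vertex `0` has an odd
union of components that avoids `0`. -/
theorem petersen_exists_odd_closed {Q : SimpleGraph (Fin 10)} (hQ : Q ≤ petersen)
    (h2 : ∀ p, p ≠ 0 → (Q.neighborSet p).ncard = 2) :
    ∃ C : Finset (Fin 10), 0 ∉ C ∧ Odd C.card ∧ ∀ x ∈ C, ∀ y, Q.Adj x y → y ∈ C := by
  classical
  have key : ∀ x a b c : Fin 10, x ≠ 0 → a ≠ b → a ≠ c → b ≠ c →
      (∀ y, petersen.Adj x y → y = a ∨ y = b ∨ y = c) →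
      twoOfThree (decide (Q.Adj x a)) (decide (Q.Adj x b)) (decide (Q.Adj x c)) = true :=
    fun x a b c hx hab hac hbc h =>
      twoOfThree_of_ncard hab hac hbc (fun y hy => by simpa using h y (hQ hy)) (h2 x hx)
  have sw : ∀ x y, decide (Q.Adj x y) = decide (Q.Adj y x) := fun x y => by
    simp [Q.adj_comm]
  have k1 := key 1 0 2 6 (by decide) (by decide) (by decide) (by decide) (by decide)
  have k2 := key 2 1 3 7 (by decide) (by decide) (by decide) (by decide) (by decide)
  have k3 := key 3 2 4 8 (by decide) (by decide) (by decide) (by decide) (by decide)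
  have k4 := key 4 3 0 9 (by decide) (by decide) (by decide) (by decide) (by decide)
  have k5 := key 5 0 7 8 (by decide) (by decide) (by decide) (by decide) (by decide)
  have k6 := key 6 1 8 9 (by decide) (by decide) (by decide) (by decide) (by decide)
  have k7 := key 7 2 5 9 (by decide) (by decide) (by decide) (by decide) (by decide)
  have k8 := key 8 3 6 5 (by decide) (by decide) (by decide) (by decide) (by decide)
  have k9 := key 9 4 7 6 (by decide) (by decide) (by decide) (by decide) (by decide)
  rw [sw 2 1] at k2
  rw [sw 3 2] at k3
  rw [sw 4 3] at k4
  rw [sw 6 1] at k6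
  rw [sw 7 2, sw 7 5] at k7
  rw [sw 8 3, sw 8 6, sw 8 5] at k8
  rw [sw 9 4, sw 9 7, sw 9 6] at k9
  have := petersen_two_factor_bool _ _ _ k1 _ _ k2 _ _ k3 _ _ k4 _ _ _ k5 _ _ k6 _ k7 k8 k9
  simp only [Bool.or_eq_false_iff, decide_eq_false_iff_not] at this
  -- If 0 is isolated, `C` is everything else. Otherwise removing a perfect matching leaves two
  -- pentagons and `C` is the one avoiding 0; each list consists of the edges leaving `C`.
  rcases this with h | h | h | h | h | h | h
  · exact ⟨{1, 2, 3, 4, 5, 6, 7, 8, 9}, by decide, by decide,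
      closed_of_list hQ _ [(1, 0), (4, 0), (5, 0)]
        (by simpa [Q.adj_comm, and_assoc] using h) (by decide)⟩
  · exact ⟨{1, 2, 6, 7, 9}, by decide, by decide,
      closed_of_list hQ _ [(1, 0), (2, 3), (9, 4), (7, 5), (6, 8)]
        (by simpa [Q.adj_comm, and_assoc] using h) (by decide)⟩
  · exact ⟨{1, 2, 3, 6, 8}, by decide, by decide,
      closed_of_list hQ _ [(1, 0), (3, 4), (2, 7), (8, 5), (6, 9)]
        (by simpa [Q.adj_comm, and_assoc] using h) (by decide)⟩
  · exact ⟨{2, 3, 5, 7, 8}, by decide, by decide,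
      closed_of_list hQ _ [(2, 1), (3, 4), (5, 0), (8, 6), (7, 9)]
        (by simpa [Q.adj_comm, and_assoc] using h) (by decide)⟩
  · exact ⟨{2, 3, 4, 7, 9}, by decide, by decide,
      closed_of_list hQ _ [(2, 1), (4, 0), (3, 8), (7, 5), (9, 6)]
        (by simpa [Q.adj_comm, and_assoc] using h) (by decide)⟩
  · exact ⟨{3, 4, 6, 8, 9}, by decide, by decide,
      closed_of_list hQ _ [(3, 2), (4, 0), (6, 1), (9, 7), (8, 5)]
        (by simpa [Q.adj_comm, and_assoc] using h) (by decide)⟩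
  · exact ⟨{5, 6, 7, 8, 9}, by decide, by decide,
      closed_of_list hQ _ [(5, 0), (6, 1), (7, 2), (8, 3), (9, 4)]
        (by simpa [Q.adj_comm, and_assoc] using h) (by decide)⟩

/-! ### Connectivity of induced subgraphs -/

theorem induce_connected_of_closed {V : Type*} {G : SimpleGraph V} {W : Set V} (hne : W.Nonempty)
    (h : ∀ X : Set V, X ⊆ W → X.Nonempty → (∀ x ∈ X, ∀ y ∈ W, G.Adj x y → y ∈ X) → W ⊆ X) :
    (G.induce W).Connected := by
  have : Nonempty W := hne.to_subtype
  refine ⟨fun a b => ?_⟩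
  have := h {y | ∃ hy : y ∈ W, (G.induce W).Reachable a ⟨y, hy⟩} (fun y hy => hy.1)
    ⟨a, a.2, SimpleGraph.Reachable.refl _⟩
    (fun x ⟨hx, hr⟩ y hy hxy =>
      ⟨hy, hr.trans (SimpleGraph.Adj.reachable (G := G.induce W) (u := ⟨x, hx⟩) (v := ⟨y, hy⟩) hxy)⟩)
    b.2
  exact this.2

theorem subset_of_induce_connected {V : Type*} {G : SimpleGraph V} {W : Set V}
    (h : (G.induce W).Connected) {X : Set V} {a : V} (ha : a ∈ W) (haX : a ∈ X)
    (hX : ∀ x ∈ X, ∀ y ∈ W, G.Adj x y → y ∈ X) : W ⊆ X := by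
  intro b hb
  obtain ⟨w⟩ := h.preconnected ⟨a, ha⟩ ⟨b, hb⟩
  have : ∀ (x y : W), (G.induce W).Walk x y → x.1 ∈ X → y.1 ∈ X := by
    intro x y w
    induction w with
    | nil => exact id
    | cons hadj _ ih => exact fun hx => ih (hX _ hx _ (Subtype.property _) hadj)
  exact this _ _ w haX

/-- `y` need not lie in `S`, which covers one-element sets. -/
theorem exists_pair_of_card_lt_three {α : Type*} {S : Finset α} (hS : S.card < 3) {x : α}
    (hx : x ∈ S) : ∃ y, ∀ z ∈ S, z = x ∨ z = y := by
  classical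
  have : Nonempty α := ⟨x⟩
  have : (S.erase x).card ≤ 1 := by
    rw [Finset.card_erase_of_mem hx]
    omega
  obtain ⟨y, hy⟩ := Finset.card_le_one_iff_subset_singleton.1 this
  refine ⟨y, fun z hz => ?_⟩
  by_cases h : z = x
  · exact Or.inl h
  · exact Or.inr (by simpa using hy (Finset.mem_erase.2 ⟨h, hz⟩))

theorem encard_neighborSet {V : Type*} (G : SimpleGraph V) (v : V) [Fintype (G.neighborSet v)] :
    (G.neighborSet v).encard = G.degree v := by
  rw [Set.encard_eq_coe_toFinset_card]
  rfl

theorem petersen_cubic : IsCubic petersen := by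
  intro v
  have : petersen.degree v = 3 := by revert v; decide
  rw [encard_neighborSet, this]
  rfl

theorem petersen_vertexConnected : IsVertexConnected 3 petersen := by
  refine ⟨by simp; norm_num, fun S hS => ?_⟩
  have hne : ∃ v, v ∉ S := by
    by_contra! h
    have : S = Finset.univ := Finset.eq_univ_iff_forall.2 h
    simp [this] at hS
  refine induce_connected_of_closed hne fun X hXW ⟨p, hp⟩ hX q hq => ?_
  obtain ⟨s, t, hst⟩ : ∃ s t, ∀ z ∈ S, z = s ∨ z = t := by
    rcases S.eq_empty_or_nonempty with rfl | ⟨s, hs⟩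
    · exact ⟨0, 0, by simp⟩
    · exact ⟨s, exists_pair_of_card_lt_three hS hs⟩
  have hW : ∀ a, a ≠ s ∧ a ≠ t → a ∈ {v | v ∉ S} := fun a ha haS => by
    rcases hst a haS with h | h
    exacts [ha.1 h, ha.2 h]
  by_cases hpq : p = q
  · exact hpq ▸ hp
  rcases petersen_short_path s t hpq with h | ⟨a, ha, h1, h2⟩ | ⟨a, b, ha, hb, h1, h2, h3⟩
  · exact hX _ hp _ hq h
  · exact hX _ (hX _ hp _ (hW _ ha) h1) _ hq h2
  · exact hX _ (hX _ (hX _ hp _ (hW _ ha) h1) _ (hW _ hb) h2) _ hq h3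

/-! ### The graph `P` -/

theorem degree_eq_two_iff : ∀ p : PVert, pGraph.degree p = 2 ↔ petersen.Adj p.1 0 := by
  decide +kernel

theorem degree_eq_two_or_three : ∀ p : PVert, pGraph.degree p = 2 ∨ pGraph.degree p = 3 := by
  decide +kernel

theorem encard_ports : {p : PVert | pGraph.degree p = 2}.encard = 3 := by
  have h : (Finset.univ.filter fun p : PVert => pGraph.degree p = 2).card = 3 := by decide +kernel
  have h' : {p : PVert | pGraph.degree p = 2} =
      (Finset.univ.filter fun p : PVert => pGraph.degree p = 2 : Finset PVert) := by
    ext; simp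
  rw [h', Set.encard_coe_eq_coe_finsetCard, h]
  rfl

theorem exists_adj_not_port : ∀ p s : PVert, petersen.Adj p.1 0 →
    ∃ q, pGraph.Adj p q ∧ q ≠ s ∧ ¬ petersen.Adj q.1 0 := by
  decide +kernel

/-- A short path of the Petersen graph from `p` to the removed vertex 0 avoids `s` and `t`; its last
vertex before 0 is the port. -/
theorem exists_port_of_closed {Y : Set PVert} {p s t : PVert} (hp : p ∈ Y) (hs : p ≠ s)
    (ht : petersen.Adj p.1 0 → p ≠ t)
    (hY : ∀ x ∈ Y, ∀ y, pGraph.Adj x y → y ≠ s → y ≠ t → y ∈ Y) :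
    ∃ q ∈ Y, pGraph.degree q = 2 ∧ q ≠ s ∧ q ≠ t := by
  have key : ∀ a : Fin 10, a ≠ s.1 ∧ a ≠ t.1 → ∀ h0 : a ≠ 0, ∀ x ∈ Y, petersen.Adj x.1 a →
      (⟨a, h0⟩ : PVert) ∈ Y := fun a ha h0 x hx hxa =>
    hY x hx ⟨a, h0⟩ hxa (fun h => ha.1 (congrArg Subtype.val h))
      (fun h => ha.2 (congrArg Subtype.val h))
  have fin : ∀ a : Fin 10, a ≠ s.1 ∧ a ≠ t.1 → ∀ h0 : a ≠ 0, (⟨a, h0⟩ : PVert) ∈ Y →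
      petersen.Adj a 0 → ∃ q ∈ Y, pGraph.degree q = 2 ∧ q ≠ s ∧ q ≠ t := fun a ha h0 hY ha0 =>
    ⟨⟨a, h0⟩, hY, (degree_eq_two_iff _).2 ha0, fun h => ha.1 (congrArg Subtype.val h),
      fun h => ha.2 (congrArg Subtype.val h)⟩
  rcases petersen_short_path s.1 t.1 p.2 with h | ⟨a, ha, h1, h2⟩ | ⟨a, b, ha, hb, h1, h2, h3⟩
  · exact ⟨p, hp, (degree_eq_two_iff p).2 h, hs, ht h⟩
  · exact fin a ha h2.ne (key a ha h2.ne p hp h1) h2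
  -- The path may run through 0 early; then `p` itself is a port.
  · by_cases h0 : a = 0
    · subst h0
      exact ⟨p, hp, (degree_eq_two_iff p).2 h1, hs, ht h1⟩
    · exact fin b hb h3.ne (key b hb h3.ne _ (key a ha h0 p hp h1) h2) h3

theorem eq_univ_of_pGraph_closed {Y : Set PVert} (hne : Y.Nonempty)
    (hY : ∀ x ∈ Y, ∀ y, pGraph.Adj x y → y ∈ Y) (q : PVert) : q ∈ Y := by
  obtain ⟨p, hp⟩ := hne
  by_cases hpq : p = q
  · exact hpq ▸ hp
  -- Deleting just the vertex 0 keeps the path inside `P`.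
  rcases petersen_short_path 0 0 (fun h => hpq (Subtype.ext h)) with
    h | ⟨a, ha, h1, h2⟩ | ⟨a, b, ha, hb, h1, h2, h3⟩
  · exact hY p hp q h
  · exact hY _ (hY p hp ⟨a, ha.1⟩ h1) _ h2
  · exact hY _ (hY _ (hY p hp ⟨a, ha.1⟩ h1) ⟨b, hb.1⟩ h2) _ h3

/-! ### Inflations of cubic graphs -/

section Inflate

variable {V : Type*} {F : SimpleGraph V}

theorem exists_attachment (hF : IsCubic F) : Nonempty (Attachment F) := by
  classical
  have : ∀ v, ∃ f : V → PVert, Set.MapsTo f (F.neighborSet v) {p | pGraph.degree p = 2} ∧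
      Set.InjOn f (F.neighborSet v) := by
    intro v
    have : Nonempty PVert := ⟨⟨1, by decide⟩⟩
    exact (Set.finite_of_encard_eq_coe (k := 3) (hF v)).exists_injOn_of_encard_le
      ((hF v).trans encard_ports.symm).le
  choose f hf hf' using this
  exact ⟨⟨f, fun v u h => hf v h, hf'⟩⟩

/-- An injection from three neighbors into three ports is onto. -/
theorem exists_port (hF : IsCubic F) (a : Attachment F) (v : V) {p : PVert}
    (hp : pGraph.degree p = 2) : ∃ u, F.Adj v u ∧ a.port v u = p := by
  have hsub : a.port v '' F.neighborSet v ⊆ {p | pGraph.degree p = 2} := by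
    rintro _ ⟨u, hu, rfl⟩
    exact a.degree_port v u hu
  have heq := (Set.toFinite _).eq_of_subset_of_encard_le hsub
    (by rw [encard_ports, (a.injOn_port v).encard_image, hF v])
  have : p ∈ a.port v '' F.neighborSet v := heq ▸ hp
  exact this

theorem inflate_cubic (hF : IsCubic F) (a : Attachment F) : IsCubic (inflate F a) := by
  rintro ⟨v, p⟩
  have hsplit : (inflate F a).neighborSet (v, p) = (Prod.mk v '' pGraph.neighborSet p) ∪
      {x | F.Adj v x.1 ∧ p = a.port v x.1 ∧ x.2 = a.port x.1 v} := by
    ext ⟨u, q⟩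
    simp only [SimpleGraph.mem_neighborSet, inflate, Set.mem_union, Set.mem_image, Prod.mk.injEq]
    constructor
    · rintro (⟨rfl, h⟩ | h)
      exacts [Or.inl ⟨q, h, rfl, rfl⟩, Or.inr h]
    · rintro (⟨q, h, rfl, rfl⟩ | h)
      exacts [Or.inl ⟨rfl, h⟩, Or.inr h]
  have hin : (Prod.mk v '' pGraph.neighborSet p).encard = pGraph.degree p := by
    rw [(Prod.mk_right_injective v).encard_image, encard_neighborSet]
  have hdisj : Disjoint (Prod.mk v '' pGraph.neighborSet p)
      {x | F.Adj v x.1 ∧ p = a.port v x.1 ∧ x.2 = a.port x.1 v} := by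
    rw [Set.disjoint_left]
    rintro _ ⟨q, -, rfl⟩ ⟨h, -⟩
    exact F.irrefl h
  rw [hsplit, Set.encard_union_eq hdisj, hin]
  rcases degree_eq_two_or_three p with hp | hp
  · obtain ⟨u, hu, rfl⟩ := exists_port hF a v hp
    have : {x : V × PVert | F.Adj v x.1 ∧ a.port v u = a.port v x.1 ∧ x.2 = a.port x.1 v} =
        {(u, a.port u v)} := by
      ext ⟨w, q⟩
      simp only [Set.mem_ofPred_eq, Set.mem_singleton_iff, Prod.mk.injEq]
      constructor
      · rintro ⟨h1, h2, h3⟩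
        obtain rfl := a.injOn_port v hu h1 h2
        exact ⟨rfl, h3⟩
      · rintro ⟨rfl, h⟩
        exact ⟨hu, rfl, h⟩
    rw [this, Set.encard_singleton, hp]
    norm_num
  · have : {x : V × PVert | F.Adj v x.1 ∧ p = a.port v x.1 ∧ x.2 = a.port x.1 v} = ∅ := by
      refine Set.eq_empty_of_forall_notMem fun x ⟨h1, h2, _⟩ => ?_
      have := a.degree_port v x.1 h1
      rw [← h2] at this
      omega
    rw [this, Set.encard_empty, hp]
    norm_num

/-! ### 3-connectedness of inflations -/

theorem mem_copy_of_closed {a : Attachment F} {W X : Set (V × PVert)} {v : V}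
    (hW : ∀ q, (v, q) ∈ W) (hX : ∀ x ∈ X, ∀ y ∈ W, (inflate F a).Adj x y → y ∈ X)
    {p : PVert} (hp : (v, p) ∈ X) (q : PVert) : (v, q) ∈ X :=
  eq_univ_of_pGraph_closed (Y := {q | (v, q) ∈ X}) ⟨p, hp⟩
    (fun _ hx _ hxy => hX _ hx _ (hW _) (Or.inl ⟨rfl, hxy⟩)) q

/-- From a copy with a deleted vertex one escapes through a port that is neither deleted nor leads
to the copy of the other deleted vertex; the copy reached is intact. -/
theorem exists_mem_untouched_copy (hF : IsCubic F) {a : Attachment F} {S : Finset (V × PVert)}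
    (hS : S.card < 3) {X : Set (V × PVert)} (hXS : ∀ x ∈ X, x ∉ S)
    (hX : ∀ x ∈ X, ∀ y ∉ S, (inflate F a).Adj x y → y ∈ X) (hne : X.Nonempty) :
    ∃ v p, (v, p) ∈ X ∧ ∀ q, (v, q) ∉ S := by
  obtain ⟨⟨v, p⟩, hp⟩ := hne
  by_cases hv : ∀ q, (v, q) ∉ S
  · exact ⟨v, p, hp, hv⟩
  push Not at hv
  obtain ⟨s, hs⟩ := hv
  obtain ⟨⟨w, t⟩, hst⟩ := exists_pair_of_card_lt_three hS hs
  have hps : p ≠ s := fun h => hXS _ hp (h ▸ hs)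
  -- leaving the copy at `v` through a port
  have leave : ∀ q, (v, q) ∈ X → ∀ u, F.Adj v u → a.port v u = q → u ≠ w →
      ∃ v p, (v, p) ∈ X ∧ ∀ q, (v, q) ∉ S := by
    intro q hq u hu hqu huw
    have hu' : ∀ q, (u, q) ∉ S := fun q hqS => by
      rcases hst _ hqS with h | h
      · exact hu.ne (congrArg Prod.fst h).symm
      · exact huw (congrArg Prod.fst h)
    exact ⟨u, a.port u v, hX _ hq _ (hu' _) (Or.inr ⟨hu, hqu.symm, rfl⟩), hu'⟩
  by_cases hwv : w = v
  · subst hwv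
    by_cases hpt : (w, t) ∈ S
    · obtain ⟨q, hq, hq2, hqs, hqt⟩ := exists_port_of_closed (Y := {q | (w, q) ∈ X}) hp hps
        (fun _ h => hXS _ hp (h ▸ hpt)) (fun x hx y hxy hys hyt => hX _ hx _ (fun hyS => by
          rcases hst _ hyS with h | h
          exacts [hys (congrArg Prod.snd h), hyt (congrArg Prod.snd h)]) (Or.inl ⟨rfl, hxy⟩))
      obtain ⟨u, hu, huq⟩ := exists_port hF a w hq2
      exact leave q hq u hu huq hu.ne'
    · obtain ⟨q, hq, hq2, hqs, hqt⟩ := exists_port_of_closed (Y := {q | (w, q) ∈ X}) hp hps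
        (fun _ => hps) (fun x hx y hxy hys hyt => hX _ hx _ (fun hyS => by
          rcases hst _ hyS with h | h
          exacts [hys (congrArg Prod.snd h), hpt (h ▸ hyS)]) (Or.inl ⟨rfl, hxy⟩))
      obtain ⟨u, hu, huq⟩ := exists_port hF a w hq2
      exact leave q hq u hu huq hu.ne'
  -- The second deletion is in another copy, so the port towards `w` plays the role of `t`. Since
  -- `p` might be that port, a starting port is first exchanged for a non-port neighbor.
  · have hclosed : ∀ x, (v, x) ∈ X → ∀ y, pGraph.Adj x y → y ≠ s → (v, y) ∈ X :=
      fun x hx y hxy hys => hX _ hx _ (fun hyS => by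
        rcases hst _ hyS with h | h
        exacts [hys (congrArg Prod.snd h), hwv (congrArg Prod.fst h).symm]) (Or.inl ⟨rfl, hxy⟩)
    obtain ⟨p', hp', hps', hpt'⟩ : ∃ p', (v, p') ∈ X ∧ p' ≠ s ∧
        (petersen.Adj p'.1 0 → p' ≠ a.port v w) := by
      by_cases h : petersen.Adj p.1 0
      · obtain ⟨q, hq1, hq2, hq3⟩ := exists_adj_not_port p s h
        exact ⟨q, hclosed _ hp _ hq1 hq2, hq2, fun h => absurd h hq3⟩
      · exact ⟨p, hp, hps, fun h' => absurd h' h⟩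
    obtain ⟨q, hq, hq2, hqs, hqt⟩ := exists_port_of_closed (Y := {q | (v, q) ∈ X}) hp' hps' hpt'
      (fun x hx y hxy hys _ => hclosed x hx y hxy hys)
    obtain ⟨u, hu, huq⟩ := exists_port hF a v hq2
    exact leave q hq u hu huq (fun h => hqt (h ▸ huq.symm))

theorem inflate_vertexConnected (hF : IsCubic F) (h3 : IsVertexConnected 3 F) (a : Attachment F) :
    IsVertexConnected 3 (inflate F a) := by
  classical
  refine ⟨h3.1.trans_le (ENat.card_le_card_of_injective
    (f := fun v => (v, (⟨1, by decide⟩ : PVert))) fun x y h => congrArg Prod.fst h), fun S hS => ?_⟩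
  set T := S.image Prod.fst with hT
  have hcon := h3.2 T (Finset.card_image_le.trans_lt hS)
  have hTS : ∀ v, v ∉ T ↔ ∀ q, (v, q) ∉ S := by
    intro v
    simp [hT]
  obtain ⟨⟨v₀, hv₀⟩⟩ := hcon.nonempty
  refine induce_connected_of_closed ⟨(v₀, ⟨1, by decide⟩), (hTS v₀).1 hv₀ _⟩ fun X hXW hne hX => ?_
  have hall : ∀ X : Set (V × PVert), (∀ x ∈ X, x ∉ S) → X.Nonempty →
      (∀ x ∈ X, ∀ y ∉ S, (inflate F a).Adj x y → y ∈ X) → ∀ v ∉ T, ∀ q, (v, q) ∈ X := by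
    intro X hXS hne hX
    obtain ⟨v, p, hp, hv⟩ := exists_mem_untouched_copy hF hS hXS hX hne
    have := subset_of_induce_connected hcon (X := {v | v ∉ T ∧ ∀ q, (v, q) ∈ X}) (a := v)
      ((hTS v).2 hv) ⟨(hTS v).2 hv, mem_copy_of_closed hv hX hp⟩ (fun x hx y hy hxy =>
        ⟨hy, mem_copy_of_closed ((hTS y).1 hy) hX
          (hX _ (hx.2 (a.port x y)) (y, a.port y x) ((hTS y).1 hy _) (Or.inr ⟨hxy, rfl, rfl⟩))⟩)
    exact fun v hv => (this hv).2
  -- Otherwise `X` and its complement among the remaining vertices are both closed and nonempty, so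
  -- both contain the intact copy at `v₀`.
  intro y hy
  by_contra hyX
  refine absurd (hall X hXW hne hX v₀ hv₀ ⟨1, by decide⟩)
    (hall {x | x ∉ S ∧ x ∉ X} (fun x hx => hx.1) ⟨y, hy, hyX⟩
      (fun x hx z hz hxz => ⟨hz, fun hzX => hx.2 (hX z hzX x hx.1 hxz.symm)⟩)
      v₀ hv₀ ⟨1, by decide⟩).2

end Inflate

/-! ### Decompositions into perfect matchings -/

/-- `G` contains three pairwise edge-disjoint perfect matchings. For a cubic graph this means that
`G` is 3-edge-colorable. -/
def IsTait {V : Type*} (G : SimpleGraph V) : Prop :=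
  ∃ M : Fin 3 → SimpleGraph V, (∀ i, M i ≤ G) ∧
    (∀ i j v w, (M i).Adj v w → (M j).Adj v w → i = j) ∧
    ∀ i v, ((M i).neighborSet v).ncard = 1

theorem ncard_neighborSet {V : Type*} (G : SimpleGraph V) (v : V) [Fintype (G.neighborSet v)] :
    (G.neighborSet v).ncard = G.degree v := by
  rw [Set.ncard_def, encard_neighborSet]
  rfl

theorem even_card_of_closed_of_ncard_eq_one {V : Type*} [Fintype V] {M : SimpleGraph V}
    (hM : ∀ v, (M.neighborSet v).ncard = 1) {C : Finset V}
    (hC : ∀ x ∈ C, ∀ y, M.Adj x y → y ∈ C) : Even C.card := by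
  classical
  let N : SimpleGraph V :=
    { Adj := fun x y => M.Adj x y ∧ x ∈ C ∧ y ∈ C
      symm := ⟨fun _ _ h => ⟨h.1.symm, h.2.2, h.2.1⟩⟩
      loopless := ⟨fun _ h => M.irrefl h.1⟩ }
  have hdeg : ∀ v, N.degree v = if v ∈ C then 1 else 0 := by
    intro v
    rw [← ncard_neighborSet]
    split_ifs with h
    · rw [← hM v]
      congr 1
      ext y
      exact ⟨fun hy => hy.1, fun hy => ⟨hy, h, hC v h y hy⟩⟩
    · rw [Set.eq_empty_of_forall_notMem (s := N.neighborSet v) fun y hy => h hy.2.1]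
      exact Set.ncard_empty V
  have hsum := N.sum_degrees_eq_twice_card_edges
  simp only [hdeg, Finset.sum_ite_mem, Finset.univ_inter, Finset.sum_const, smul_eq_mul,
    mul_one] at hsum
  exact ⟨_, hsum.trans (two_mul _)⟩

/-- The union of two matchings is 2-regular, so it has an odd closed set, which the first matching
would pair off. -/
theorem petersen_not_isTait : ¬ IsTait petersen := by
  rintro ⟨M, hle, hdisj, hM⟩
  obtain ⟨C, -, hodd, hC⟩ := petersen_exists_odd_closed (Q := M 0 ⊔ M 1)
    (sup_le (hle 0) (hle 1)) (fun p _ => by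
      have : (M 0 ⊔ M 1).neighborSet p = (M 0).neighborSet p ∪ (M 1).neighborSet p := by
        ext; simp
      rw [this, Set.ncard_union_eq, hM, hM]
      rw [Set.disjoint_left]
      intro y h0 h1
      exact absurd (hdisj 0 1 p y h0 h1) (by decide))
  exact Nat.not_even_iff_odd.2 hodd
    (even_card_of_closed_of_ncard_eq_one (hM 0) fun x hx y hxy => hC x hx y (Or.inl hxy))

/-! ### Parity in the copies of `P` -/

section Cut

variable {V : Type*} {F : SimpleGraph V}

/-- The neighbors `u` of `v` such that the edge of the inflation that comes from `vu` lies in `M`. -/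
def cut (a : Attachment F) (M : SimpleGraph (V × PVert)) (v : V) : Set V :=
  {u | F.Adj v u ∧ M.Adj (v, a.port v u) (u, a.port u v)}

theorem cut_finite (hF : IsCubic F) (a : Attachment F) (M : SimpleGraph (V × PVert)) (v : V) :
    (cut a M v).Finite :=
  (Set.finite_of_encard_eq_coe (k := 3) (hF v)).subset fun _ h => h.1

theorem mem_cut {a : Attachment F} {M : SimpleGraph (V × PVert)} (hM : M ≤ inflate F a) {v : V}
    {p : PVert} {y : V × PVert} (h : M.Adj (v, p) y) (hv : y.1 ≠ v) :
    y.1 ∈ cut a M v ∧ a.port v y.1 = p ∧ y.2 = a.port y.1 v := by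
  rcases hM h with ⟨h1, -⟩ | ⟨h1, h2, h3⟩
  · exact absurd h1.symm hv
  · dsimp only at h1 h2 h3
    refine ⟨⟨h1, ?_⟩, h2.symm, h3⟩
    rw [← h2, ← h3]
    exact h

/-- Handshake lemma for one copy; `k` counts the edges of `M` inside it. -/
theorem sum_ncard_neighborSet (hF : IsCubic F) {a : Attachment F} {M : SimpleGraph (V × PVert)}
    (hM : M ≤ inflate F a) (v : V) :
    ∃ k, ∑ p, (M.neighborSet (v, p)).ncard = 2 * k + (cut a M v).ncard := by
  classical
  have hfin := cut_finite hF a M v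
  let N := M.comap (Prod.mk v)
  have hsplit : ∀ p, (M.neighborSet (v, p)).ncard =
      N.degree p + (hfin.toFinset.filter fun u => a.port v u = p).card := by
    intro p
    have h : M.neighborSet (v, p) = (Prod.mk v '' N.neighborSet p) ∪
        (fun u => (u, a.port u v)) '' (hfin.toFinset.filter fun u => a.port v u = p : Finset V) := by
      ext ⟨u, q⟩
      simp only [SimpleGraph.mem_neighborSet, Set.mem_union, Set.mem_image, Prod.mk.injEq,
        Finset.coe_filter, Set.Finite.mem_toFinset, Set.mem_ofPred_eq]
      constructor
      · intro h
        by_cases hu : u = v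
        · subst hu
          exact Or.inl ⟨q, h, rfl, rfl⟩
        · obtain ⟨h1, h2, h3⟩ := mem_cut hM h hu
          exact Or.inr ⟨u, ⟨h1, h2⟩, rfl, h3.symm⟩
      · rintro (⟨q, h, rfl, rfl⟩ | ⟨u, ⟨h, rfl⟩, rfl, rfl⟩)
        exacts [h, h.2]
    rw [h, Set.ncard_union_eq, Set.ncard_image_of_injective _ (Prod.mk_right_injective v),
      ncard_neighborSet, Set.ncard_image_of_injective, Set.ncard_coe_finset]
    · exact fun x y h => congrArg Prod.fst h
    · rw [Set.disjoint_left]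
      rintro _ ⟨q, -, rfl⟩ ⟨u, hu, h⟩
      obtain rfl : u = v := congrArg Prod.fst h
      have : u ∈ cut a M u := by simpa using (Finset.mem_filter.1 hu).1
      exact F.irrefl this.1
  refine ⟨N.edgeFinset.card, ?_⟩
  rw [Finset.sum_congr rfl fun p _ => hsplit p, Finset.sum_add_distrib,
    N.sum_degrees_eq_twice_card_edges, Set.ncard_eq_toFinset_card _ hfin,
    ← Finset.card_eq_sum_card_fiberwise (fun _ _ => Finset.mem_coe.2 (Finset.mem_univ _))]

variable {a : Attachment F} {M : Fin 3 → SimpleGraph (V × PVert)}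

theorem sum_ncard_cut_le (hF : IsCubic F)
    (hdisj : ∀ i j v w, (M i).Adj v w → (M j).Adj v w → i = j) (v : V) :
    (cut a (M 0) v).ncard + (cut a (M 1) v).ncard + (cut a (M 2) v).ncard ≤ 3 := by
  have hd : ∀ i j, i ≠ j → Disjoint (cut a (M i) v) (cut a (M j) v) := fun i j hij =>
    Set.disjoint_left.2 fun u hi hj => hij (hdisj i j _ _ hi.2 hj.2)
  have hfin := fun i => cut_finite hF a (M i) v
  rw [← Set.ncard_union_eq (hd 0 1 (by decide)) (hfin 0) (hfin 1),
    ← Set.ncard_union_eq (Set.disjoint_union_left.2 ⟨hd 0 2 (by decide), hd 1 2 (by decide)⟩)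
      ((hfin 0).union (hfin 1)) (hfin 2)]
  have h3 : (F.neighborSet v).ncard = 3 := by
    rw [Set.ncard_def, hF v]
    rfl
  refine le_of_le_of_eq (Set.ncard_le_ncard ?_ (Set.finite_of_encard_eq_coe (k := 3) (hF v))) h3
  rintro u ((h | h) | h) <;> exact h.1

theorem isTait_of_odd_cut (hF : IsCubic F)
    (hdisj : ∀ i j v w, (M i).Adj v w → (M j).Adj v w → i = j)
    (hodd : ∀ i v, Odd (cut a (M i) v).ncard) : IsTait F := by
  refine ⟨fun i =>
    { Adj := fun v u => F.Adj v u ∧ (M i).Adj (v, a.port v u) (u, a.port u v)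
      symm := ⟨fun v u h => ⟨h.1.symm, h.2.symm⟩⟩
      loopless := ⟨fun v h => F.irrefl h.1⟩ }, fun i v u h => h.1,
    fun i j v u hi hj => hdisj i j _ _ hi.2 hj.2, fun i v => ?_⟩
  change (cut a (M i) v).ncard = 1
  have h := sum_ncard_cut_le (a := a) hF hdisj v
  obtain ⟨x, hx⟩ := hodd 0 v
  obtain ⟨y, hy⟩ := hodd 1 v
  obtain ⟨z, hz⟩ := hodd 2 v
  -- Three odd numbers with sum at most 3 are all 1.
  fin_cases i <;> simp only [Fin.zero_eta, Fin.mk_one, Fin.reduceFinMk] <;> omega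

theorem isTait_of_inflate (hF : IsCubic F) (h : IsTait (inflate F a)) : IsTait F := by
  obtain ⟨M, hle, hdisj, hM⟩ := h
  refine isTait_of_odd_cut (a := a) hF hdisj fun i v => ?_
  obtain ⟨k, hk⟩ := sum_ncard_neighborSet hF (hle i) v
  have h9 : Fintype.card PVert = 9 := by decide
  simp only [hM, Finset.sum_const, Finset.card_univ, h9, smul_eq_mul] at hk
  -- The cut has size 9 - 2k = 2(4 - k) + 1.
  exact ⟨4 - k, by omega⟩

end Cut

/-! ### Frames -/

/-- The structure that a spanning subdivision of a Kotzig graph induces on `G`: `M i` consists of the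
edges subdividing the `i`-th color class, and `B` is the set of branch vertices. -/
structure Frame {V : Type*} (G : SimpleGraph V) (M : Fin 3 → SimpleGraph V) (B : Set V) : Prop where
  le : ∀ i, M i ≤ G
  disj : ∀ i j v w, (M i).Adj v w → (M j).Adj v w → i = j
  branch : ∀ v ∈ B, ∀ i, ((M i).neighborSet v).ncard = 1
  inner : ∀ v ∉ B, ∃ i, ((M i).neighborSet v).ncard = 2 ∧ ∀ j, j ≠ i → (M j).neighborSet v = ∅
  -- What remains of hamiltonicity: no union of components of two colours separates branch vertices.
  pair : ∀ i j, i ≠ j → ∀ X : Set V,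
    (∀ x ∈ X, ∀ y ∉ X, ¬ (M i).Adj x y ∧ ¬ (M j).Adj x y) → B ⊆ X ∨ Disjoint B X
  -- Every component of the subdivision has a branch vertex.
  reach : ∀ X : Set V, X.Nonempty → (∀ i, ∀ x ∈ X, ∀ y ∉ X, ¬ (M i).Adj x y) → (X ∩ B).Nonempty

namespace Frame

variable {V : Type*} {F : SimpleGraph V} {a : Attachment F} {M : Fin 3 → SimpleGraph (V × PVert)}
  {B : Set (V × PVert)}

/-- In each colour a branch vertex has degree 1 and any other vertex 0 or 2. The right-hand side
does not depend on `i`, so the three cuts agree in parity. -/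
theorem even_cut_iff (hf : Frame (inflate F a) M B) (hF : IsCubic F) (v : V) (i : Fin 3) :
    Even (cut a (M i) v).ncard ↔ Even {p | (v, p) ∈ B}.ncard := by
  classical
  obtain ⟨k, hk⟩ := sum_ncard_neighborSet hF (hf.le i) v
  have hp : ∀ p, ((M i).neighborSet (v, p)).ncard ≡ (if (v, p) ∈ B then 1 else 0) [MOD 2] := by
    intro p
    split_ifs with h
    · rw [hf.branch _ h i]
    · obtain ⟨j, hj, hj'⟩ := hf.inner _ h
      by_cases hij : i = j
      · rw [hij, hj]
        rfl
      · rw [hj' i hij, Set.ncard_empty]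
  have hsum : ∑ p, ((M i).neighborSet (v, p)).ncard ≡ {p | (v, p) ∈ B}.ncard [MOD 2] := by
    have h : {p | (v, p) ∈ B} = (Finset.univ.filter fun p => (v, p) ∈ B : Finset PVert) := by
      ext; simp
    rw [h, Set.ncard_coe_finset, Finset.card_filter]
    exact Nat.ModEq.sum fun p _ => hp p
  rw [hk] at hsum
  unfold Nat.ModEq at hsum
  rw [Nat.even_iff, Nat.even_iff]
  omega

theorem exists_mem_copy (hf : Frame (inflate F a) M B) (v : V) : ∃ p, (v, p) ∈ B := by
  classical
  by_contra! hB
  -- Contract everything outside the copy to the removed vertex 0.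
  let proj : V × PVert → Fin 10 := fun y => if y.1 = v then y.2.1 else 0
  let Q : SimpleGraph (Fin 10) := SimpleGraph.fromRel fun x y =>
    ∃ i p w, (M i).Adj (v, p) w ∧ p.1 = x ∧ proj w = y
  have hadj : ∀ i p w, (M i).Adj (v, p) w → petersen.Adj p.1 (proj w) := by
    intro i p w h
    by_cases hw : w.1 = v
    · simp only [proj, hw, if_true]
      rcases hf.le i h with h | h
      · exact h.2
      · exact absurd h.1 (hw ▸ F.irrefl)
    · simp only [proj, hw, if_false]
      obtain ⟨h1, h2, -⟩ := mem_cut (hf.le i) h hw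
      exact (degree_eq_two_iff p).1 (h2 ▸ a.degree_port v _ h1.1)
  have hQ : Q ≤ petersen := by
    intro x y h
    rcases ((SimpleGraph.fromRel_adj _ _ _).1 h).2 with
      ⟨i, p, w, hw, rfl, rfl⟩ | ⟨i, p, w, hw, rfl, rfl⟩
    exacts [hadj i p w hw, (hadj i p w hw).symm]
  have hMQ : ∀ i p w, (M i).Adj (v, p) w → Q.Adj p.1 (proj w) := fun i p w h =>
    (SimpleGraph.fromRel_adj _ _ _).2 ⟨(hadj i p w h).ne, Or.inl ⟨i, p, w, h, rfl, rfl⟩⟩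
  have hQM : ∀ (p : PVert) y, Q.Adj p.1 y → ∃ i w, (M i).Adj (v, p) w ∧ proj w = y := by
    intro p y h
    rcases ((SimpleGraph.fromRel_adj _ _ _).1 h).2 with
      ⟨i, q, w, hw, hq, rfl⟩ | ⟨i, q, ⟨u, w⟩, hw, rfl, hq⟩
    · obtain rfl : q = p := Subtype.ext hq
      exact ⟨i, w, hw, rfl⟩
    · by_cases hu : u = v
      · subst hu
        have : w = p := Subtype.ext (by simpa [proj] using hq)
        subst this
        exact ⟨i, (u, q), hw.symm, by simp [proj]⟩
      · simp only [proj, hu, if_false] at hq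
        exact absurd hq.symm p.2
  obtain ⟨C, h0, hodd, hC⟩ := petersen_exists_odd_closed hQ (fun x hx => by
    obtain ⟨i, h2, hi⟩ := hf.inner _ (hB ⟨x, hx⟩)
    have himg : Q.neighborSet x = proj '' (M i).neighborSet (v, ⟨x, hx⟩) := by
      ext y
      constructor
      · intro h
        obtain ⟨j, w, hw, rfl⟩ := hQM ⟨x, hx⟩ y h
        by_cases hji : j = i
        · exact ⟨w, hji ▸ hw, rfl⟩
        · have : w ∈ (M j).neighborSet (v, ⟨x, hx⟩) := hw
          rw [hi j hji] at this
          exact this.elim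
      · rintro ⟨w, hw, rfl⟩
        exact hMQ i _ w hw
    rw [himg, Set.InjOn.ncard_image, h2]
    -- At most one edge leaves the copy at a given port, so contraction preserves the degree 2.
    rintro ⟨u, q⟩ hu ⟨u', q'⟩ hu' heq
    simp only [proj] at heq
    split_ifs at heq with h h' h'
    · exact Prod.ext (h.trans h'.symm) (Subtype.ext heq)
    · exact absurd heq q.2
    · exact absurd heq.symm q'.2
    · obtain ⟨h1, h2, h3⟩ := mem_cut (hf.le i) hu h
      obtain ⟨h1', h2', h3'⟩ := mem_cut (hf.le i) hu' h'
      dsimp only at h1 h2 h3 h1' h2' h3'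
      obtain rfl := a.injOn_port v h1.1 h1'.1 (h2.trans h2'.symm)
      rw [h3, h3'])
  obtain ⟨c, hc⟩ : C.Nonempty := Finset.card_pos.1 hodd.pos
  obtain ⟨⟨u, q⟩, ⟨rfl, -⟩, hb⟩ := hf.reach {y | y.1 = v ∧ y.2.1 ∈ C}
    ⟨(v, ⟨c, fun h => h0 (h ▸ hc)⟩), rfl, hc⟩ (by
      rintro i ⟨u, p⟩ ⟨hu, hp⟩ w hw h
      dsimp only at hu hp
      subst hu
      have := hC _ hp _ (hMQ i p w h)
      by_cases hwu : w.1 = u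
      · simp only [proj, hwu, if_true] at this
        exact hw ⟨hwu, this⟩
      · simp only [proj, hwu, if_false] at this
        exact h0 this)
  exact hB q hb

theorem isTait [Nontrivial V] (hf : Frame (inflate F a) M B) (hF : IsCubic F) : IsTait F := by
  refine isTait_of_odd_cut (a := a) hF hf.disj fun i v => ?_
  rw [← Nat.not_even_iff_odd, hf.even_cut_iff hF]
  intro heven
  have hle := sum_ncard_cut_le (a := a) hF hf.disj v
  obtain ⟨x, hx⟩ := (hf.even_cut_iff hF v 0).2 heven
  obtain ⟨y, hy⟩ := (hf.even_cut_iff hF v 1).2 heven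
  obtain ⟨z, hz⟩ := (hf.even_cut_iff hF v 2).2 heven
  -- Of three even numbers with sum at most 3, at least two vanish.
  obtain ⟨j, k, hjk, hj, hk⟩ : ∃ j k : Fin 3, j ≠ k ∧ (cut a (M j) v).ncard = 0 ∧
      (cut a (M k) v).ncard = 0 := by
    by_cases h0 : (cut a (M 0) v).ncard = 0
    · by_cases h1 : (cut a (M 1) v).ncard = 0
      · exact ⟨0, 1, by decide, h0, h1⟩
      · exact ⟨0, 2, by decide, h0, by omega⟩
    · exact ⟨1, 2, by decide, by omega, by omega⟩
  have hcross : ∀ j, (cut a (M j) v).ncard = 0 → ∀ x ∈ {x : V × PVert | x.1 = v},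
      ∀ y ∉ {x : V × PVert | x.1 = v}, ¬ (M j).Adj x y := by
    rintro j hj ⟨u, p⟩ rfl y hy h
    have := (mem_cut (hf.le j) h hy).1
    rw [(Set.ncard_eq_zero (cut_finite hF a (M j) u)).1 hj] at this
    exact this
  obtain ⟨w, hw⟩ := exists_ne v
  rcases hf.pair j k hjk {x | x.1 = v} (fun x hx y hy => ⟨hcross j hj x hx y hy, hcross k hk x hx y hy⟩)
    with h | h
  · obtain ⟨p, hp⟩ := hf.exists_mem_copy w
    exact hw (h hp)
  · obtain ⟨p, hp⟩ := hf.exists_mem_copy v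
    exact Set.disjoint_left.1 h hp rfl

end Frame

/-! ### Kotzig graphs and their subdivisions -/

theorem mem_iff_of_walk {V : Type*} {H : SimpleGraph V} {X : Set V} {a b : V} (w : H.Walk a b)
    (h : ∀ x y, s(x, y) ∈ w.edges → (x ∈ X ↔ y ∈ X)) : ∀ z ∈ w.support, (z ∈ X ↔ a ∈ X) := by
  induction w with
  | nil => simp
  | cons hadj w ih =>
    intro z hz
    rw [SimpleGraph.Walk.support_cons, List.mem_cons] at hz
    rcases hz with rfl | hz
    · rfl
    · rw [ih (fun x y hxy => h x y (by simp [hxy])) z hz]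
      exact (h _ _ (by simp)).symm

theorem ncard_neighborSet_of_isPath {V : Type*} {H : SimpleGraph V} {a b v : V} {w : H.Walk a b}
    (hw : w.IsPath) (hv : v ∈ w.support) (ha : v ≠ a) (hb : v ≠ b) :
    (w.toSubgraph.neighborSet v).ncard = 2 := by
  obtain ⟨n, rfl, hn⟩ := SimpleGraph.Walk.mem_support_iff_exists_getVert.1 hv
  refine hw.ncard_neighborSet_toSubgraph_internal_eq_two (fun h => ha (by simp [h]))
    (lt_of_le_of_ne hn fun h => hb (by simp [h]))

section Kotzig

variable {α β : Type*} {K : Graph α β} {c : β → Fin 3}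

/-- Without loops, three distinct edges meet at `x`; their colours differ, so all three occur. -/
theorem exists_inc_of_color (hK : IsCubicMulti K) (hc : IsEdgeColoring K c) {x : α} (hx : x ∈ V(K))
    (i : Fin 3) : ∃ e, K.Inc e x ∧ c e = i := by
  have h3 := hK x hx
  have h0 : {e | K.IsLoopAt e x} = ∅ := Set.eq_empty_of_forall_notMem fun e => hc.1 e x
  rw [h0, Set.encard_empty, mul_zero, add_zero] at h3
  have hinj : Set.InjOn c {e | K.IsNonloopAt e x} := fun e he f hf hef => by
    by_contra hne
    exact hc.2 e f x he.inc hf.inc hne hef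
  have huniv := (Set.toFinite _).eq_of_subset_of_encard_le
    (Set.subset_univ (c '' {e | K.IsNonloopAt e x}))
    (by rw [hinj.encard_image, h3, Set.encard_univ]; simp)
  obtain ⟨e, he, rfl⟩ : i ∈ c '' {e | K.IsNonloopAt e x} := huniv ▸ Set.mem_univ i
  exact ⟨e, he.inc, rfl⟩

theorem IsHamiltonianCircuit.forall_mem_or {F : Set β} (h : IsHamiltonianCircuit K F) {Y : Set α}
    (hY : ∀ e ∈ F, ∀ x y, K.IsLink e x y → (x ∈ Y ↔ y ∈ Y)) :
    (∀ x ∈ V(K), x ∈ Y) ∨ ∀ x ∈ V(K), x ∉ Y := by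
  obtain ⟨n, v, e, hn, hv, he, hl⟩ := h
  have : NeZero n := ⟨hn⟩
  have hstep : ∀ i, v i ∈ Y ↔ v (i + 1) ∈ Y := fun i =>
    hY (e i) (he.mapsTo (Set.mem_univ i)) _ _ (hl i)
  have hnat : ∀ k : ℕ, v (k : ZMod n) ∈ Y ↔ v 0 ∈ Y := by
    intro k
    induction k with
    | zero => simp
    | succ k ih => rw [Nat.cast_succ, ← hstep, ih]
  have hall : ∀ x ∈ V(K), x ∈ Y ↔ v 0 ∈ Y := by
    intro x hx
    obtain ⟨i, -, rfl⟩ := hv.surjOn hx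
    rw [← ZMod.natCast_zmod_val i]
    exact hnat _
  by_cases h0 : v 0 ∈ Y
  · exact Or.inl fun x hx => (hall x hx).2 h0
  · exact Or.inr fun x hx hxY => h0 ((hall x hx).1 hxY)

variable {V : Type*} {H : SimpleGraph V}

namespace Subdivision

/-- The edges of a subdivision that subdivide edges of color `i`. -/
def colorGraph (D : Subdivision H K) (c : β → Fin 3) (i : Fin 3) : SimpleGraph V where
  Adj v w := ∃ e : E(K), c e = i ∧ s(v, w) ∈ (D.path e).edges
  symm := ⟨fun _ _ ⟨e, he, h⟩ => ⟨e, he, Sym2.eq_swap ▸ h⟩⟩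
  loopless := ⟨fun _ ⟨e, _, h⟩ => H.irrefl ((D.path e).adj_of_mem_edges h)⟩

theorem src_ne_tgt (D : Subdivision H K) (hc : IsEdgeColoring K c) (e : E(K)) :
    D.src e ≠ D.tgt e := fun h => hc.1 e (D.src e) (by
  have := D.isLink e
  rw [← h] at this
  exact this)

theorem inc_of_branch_mem (D : Subdivision H K) {e : E(K)} {x : α} (hx : x ∈ V(K))
    (h : D.branch x ∈ (D.path e).support) : K.Inc e x := by
  rcases D.branch_mem e x hx h with rfl | rfl
  exacts [(D.isLink e).inc_left, (D.isLink e).inc_right]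

theorem neighborSet_colorGraph (D : Subdivision H K) {e : E(K)} {v : V}
    (h : ∀ f : E(K), c f = c e → v ∈ (D.path f).support → f = e) :
    (D.colorGraph c (c e)).neighborSet v = (D.path e).toSubgraph.neighborSet v := by
  ext w
  rw [SimpleGraph.mem_neighborSet, SimpleGraph.Subgraph.mem_neighborSet,
    SimpleGraph.Walk.adj_toSubgraph_iff_mem_edges]
  constructor
  · rintro ⟨f, hf, hw⟩
    rwa [← h f hf ((D.path f).fst_mem_support_of_mem_edges hw)]
  · exact fun hw => ⟨e, rfl, hw⟩

theorem mem_iff_of_not_adj (D : Subdivision H K) {X : Set V} {e : E(K)}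
    (hX : ∀ x ∈ X, ∀ y ∉ X, ¬ (D.colorGraph c (c e)).Adj x y) :
    ∀ z ∈ (D.path e).support, (z ∈ X ↔ D.branch (D.src e) ∈ X) :=
  mem_iff_of_walk _ fun x y hxy => by
    have h : (D.colorGraph c (c e)).Adj x y := ⟨e, rfl, hxy⟩
    constructor
    · intro hx
      by_contra hy
      exact hX x hx y hy h
    · intro hy
      by_contra hx
      exact hX y hy x hx h.symm

/-- A subdividing path lies on one side of any set that its colour does not cross. Hence such sets
pull back along `branch` to sets that the circuits of `K` do not cross, and any vertex can be traced
to a branch vertex. -/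
theorem frame (D : Subdivision H K) {G : SimpleGraph V} (hHG : H ≤ G) (hK : IsCubicMulti K)
    (hc : IsEdgeColoring K c)
    (hH : ∀ i j, i ≠ j → IsHamiltonianCircuit K {e | e ∈ E(K) ∧ (c e = i ∨ c e = j)}) :
    Frame G (D.colorGraph c) (D.branch '' V(K)) where
  le i v w := fun ⟨e, _, h⟩ => hHG ((D.path e).adj_of_mem_edges h)
  disj i j v w := fun ⟨e, he, hv⟩ ⟨f, hf, hw⟩ => by
    by_cases hef : e = f
    · rw [← he, ← hf, hef]
    · exact absurd hw (D.edges_disjoint e f hef _ hv)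
  branch := by
    rintro _ ⟨x, hx, rfl⟩ i
    obtain ⟨e, he, rfl⟩ := exists_inc_of_color hK hc hx i
    lift e to E(K) using he.edge_mem
    rw [D.neighborSet_colorGraph fun f hf hfx => ?_]
    · have hne : ¬ (D.path e).Nil := SimpleGraph.Walk.not_nil_of_ne fun h =>
        D.src_ne_tgt hc e (D.injOn_branch (D.isLink e).left_mem (D.isLink e).right_mem h)
      have hp := D.isPath e (D.src_ne_tgt hc e)
      rcases he.eq_or_eq_of_isLink (D.isLink e) with rfl | rfl
      · rw [hp.neighborSet_toSubgraph_startpoint hne, Set.ncard_singleton]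
      · rw [hp.neighborSet_toSubgraph_endpoint hne, Set.ncard_singleton]
    · by_contra hne
      exact hc.2 f e x (D.inc_of_branch_mem hx hfx) he (fun h => hne (Subtype.ext h)) hf
  inner v hv := by
    obtain ⟨e, he⟩ := (D.cover_vertex v).resolve_left hv
    have huniq : ∀ f : E(K), v ∈ (D.path f).support → f = e := fun f hf => by
      by_contra hne
      exact hv (D.support_inter f e hne v hf he)
    refine ⟨c e, ?_, fun j hj => Set.eq_empty_of_forall_notMem fun w ⟨f, hf, hw⟩ => hj ?_⟩
    · rw [D.neighborSet_colorGraph fun f _ => huniq f]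
      exact ncard_neighborSet_of_isPath (D.isPath e (D.src_ne_tgt hc e)) he
        (fun h => hv ⟨_, (D.isLink e).left_mem, h.symm⟩)
        (fun h => hv ⟨_, (D.isLink e).right_mem, h.symm⟩)
    · rw [← hf, huniq f ((D.path f).fst_mem_support_of_mem_edges hw)]
  pair i j hij X hX := by
    rcases (hH i j hij).forall_mem_or (Y := D.branch ⁻¹' X) (fun e ⟨he, hij⟩ x y hxy => by
      lift e to E(K) using he
      have hX' : ∀ x ∈ X, ∀ y ∉ X, ¬ (D.colorGraph c (c e)).Adj x y := fun x hx y hy => by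
        rcases hij with h | h <;> rw [h]
        exacts [(hX x hx y hy).1, (hX x hx y hy).2]
      have hend := D.mem_iff_of_not_adj hX' _ (D.path e).end_mem_support
      rcases (D.isLink e).eq_and_eq_or_eq_and_eq hxy with ⟨rfl, rfl⟩ | ⟨rfl, rfl⟩
      exacts [hend.symm, hend]) with h | h
    · left
      rintro _ ⟨x, hx, rfl⟩
      exact h x hx
    · right
      rw [Set.disjoint_left]
      rintro _ ⟨x, hx, rfl⟩
      exact h x hx
  reach X := by
    rintro ⟨v, hv⟩ hX
    rcases D.cover_vertex v with ⟨x, hx, rfl⟩ | ⟨e, he⟩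
    · exact ⟨_, hv, x, hx, rfl⟩
    · exact ⟨_, (D.mem_iff_of_not_adj (hX (c e)) v he).1 hv, _, (D.isLink e).left_mem, rfl⟩

end Subdivision

end Kotzig

theorem HasSpanningKotzigSubdivision.exists_frame {V : Type*} {G : SimpleGraph V}
    (h : HasSpanningKotzigSubdivision G) : ∃ M B, Frame G M B := by
  obtain ⟨H, hH, α, β, K, ⟨hK, c, hc, hham⟩, ⟨D⟩⟩ := h
  exact ⟨_, _, D.frame hH hK hc hham⟩

/-! ### Iterated inflations of the Petersen graph -/

theorem nontrivial_of_isVertexConnected {V : Type*} {G : SimpleGraph V}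
    (h : IsVertexConnected 3 G) : Nontrivial V :=
  (ENat.one_lt_card_iff_nontrivial V).1 (lt_trans (by norm_num) h.1)

theorem isIterate_petersen : ∀ {k : ℕ} {G : SimpleGraph (IterVert (Fin 10) k)},
    IsIterate petersen k G → IsVertexConnected 3 G ∧ IsCubic G ∧ ¬ IsTait G
  | 0, G, h => by
    obtain rfl : G = petersen := h
    exact ⟨petersen_vertexConnected, petersen_cubic, petersen_not_isTait⟩
  | k + 1, _, ⟨F, a, hF, h⟩ => by
    subst h
    obtain ⟨h3, hcub, hT⟩ := isIterate_petersen hF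
    exact ⟨inflate_vertexConnected hcub h3 a, inflate_cubic hcub a,
      fun h => hT (isTait_of_inflate hcub h)⟩

theorem exists_isIterate_petersen :
    ∀ k, ∃ G : SimpleGraph (IterVert (Fin 10) k), IsIterate petersen k G
  | 0 => ⟨petersen, rfl⟩
  | k + 1 => by
    obtain ⟨F, hF⟩ := exists_isIterate_petersen k
    obtain ⟨a⟩ := exists_attachment (isIterate_petersen hF).2.1
    exact ⟨inflate F a, F, a, hF, rfl⟩

/-- The obstruction is in the previous iterate `F`, which is not 3-edge-colorable. -/
theorem not_hasSpanningKotzigSubdivision {k : ℕ} {G : SimpleGraph (IterVert (Fin 10) (k + 1))}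
    (hG : IsIterate petersen (k + 1) G) : ¬ HasSpanningKotzigSubdivision G := by
  obtain ⟨F, a, hF, h⟩ := hG
  subst h
  obtain ⟨h3, hcub, hT⟩ := isIterate_petersen hF
  have := nontrivial_of_isVertexConnected h3
  intro h
  obtain ⟨M, B, hf⟩ := h.exists_frame
  exact hT (hf.isTait hcub)

end KotzigFrame

theorem mainTheorem3 :
    (∀ k : ℕ, 1 ≤ k →
      (∃ G : SimpleGraph (KotzigFrame.IterVert (Fin 10) k),
        KotzigFrame.IsIterate KotzigFrame.petersen k G) ∧
      ∀ G : SimpleGraph (KotzigFrame.IterVert (Fin 10) k),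
        KotzigFrame.IsIterate KotzigFrame.petersen k G →
          KotzigFrame.IsVertexConnected 3 G ∧ KotzigFrame.IsCubic G ∧
            ¬ KotzigFrame.HasSpanningKotzigSubdivision G) ∧
    ¬ KotzigFrame.HaggkvistMarkstromConjecture := by
  have main : ∀ k : ℕ, 1 ≤ k → ∀ G : SimpleGraph (KotzigFrame.IterVert (Fin 10) k),
      KotzigFrame.IsIterate KotzigFrame.petersen k G →
        KotzigFrame.IsVertexConnected 3 G ∧ KotzigFrame.IsCubic G ∧
          ¬ KotzigFrame.HasSpanningKotzigSubdivision G := by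
    intro k hk G hG
    obtain ⟨k, rfl⟩ := Nat.exists_eq_succ_of_ne_zero (Nat.one_le_iff_ne_zero.1 hk)
    exact ⟨(KotzigFrame.isIterate_petersen hG).1, (KotzigFrame.isIterate_petersen hG).2.1,
      KotzigFrame.not_hasSpanningKotzigSubdivision hG⟩
  refine ⟨fun k hk => ⟨KotzigFrame.exists_isIterate_petersen k, main k hk⟩, fun hconj => ?_⟩
  -- A single inflation, on 90 vertices, refutes the conjecture.
  obtain ⟨G, hG⟩ := KotzigFrame.exists_isIterate_petersen 1
  obtain ⟨h3, hcub, hno⟩ := main 1 le_rfl G hG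
  have : Finite (KotzigFrame.IterVert (Fin 10) 1) :=
    inferInstanceAs (Finite (Fin 10 × KotzigFrame.PVert))
  exact hno (hconj _ G h3 hcub)
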